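/- **Model.** Let $G$ be a finite simple undirected graph with $n$ vertices and $m\ge 1$ edges. Its vertices are labelled arbitrarily by $[n]$, and for every vertex $v$ the neighbors of $v$ are labelled arbitrarily by $[d(v)]$, where $d(v)$ is the degree of $v$. A randomized algorithm knows $n$ and may ask three kinds of queries: given $i\in[n]$, the $i$-th vertex; given a vertex $v$, its degree $d(v)$; given a vertex $v$ and $j\in[d(v)]$, the $j$-th neighbor of $v$. The expected query complexity is the expected number of queries in a run. A uniformly random neighbor of $v$ is obtained by asking for $d(v)$ and then for the $j$-th neighbor, $j$ uniform in $[d(v)]$. **Bernoulli factory.** Call $F$ a factory for $1/(2p)$ if $F$ is a randomized algorithm, not depending on $p$, that may use its own randomness and independent $\mathrm{Bern}(p)$ trials and such that, for every $p\in[2/3,1]$, it outputs a bit with distribution $\mathrm{Bern}(1/(2p))$ and uses an expected number of trials bounded by a constant not depending on $p$. **Algorithm.** The input is a number $\tilde m$ (an estimate of $m$); put $\theta=\lceil\sqrt{6\tilde m}\,\rceil$. A vertex is *light* if its degree is at most $\theta$, and *heavy* otherwise. *Attempt:* Draw a uniformly random vertex $u$ and a uniform $j\in[\theta]$. Fail if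 $d(u)>\theta$ or $j>d(u)$. Otherwise let $v$ be the $j$-th neighbor of $u$, and draw $B\sim\mathrm{Bern}(1/3)$. If $B=1$, return $uv$. If $B=0$ and $v$ is heavy, return $vw$ for a uniformly random neighbor $w$ of $v$. Otherwise fail. *Sampling algorithm:* Repeat the following. Make an attempt; if it returns $vw$ with $v$ light, return $vw$. If it returns $vw$ with $v$ heavy, run $F$ on the trials "a fresh uniformly random neighbor of $v$ is light", and return $vw$ if $F$ outputs $1$. In all other cases, go on with the next repetition. **Theorem.** A factory $F$ for $1/(2p)$ exists. Moreover, for every such factory $F$ and every $a\in\mathbb R$ there is a constant $C$, depending only on $F$ and $a$, such that for every graph $G$ with $m\ge1$ edges, every labelling of its vertices and neighbors, and every real $\tilde m$ with $m\le\tilde m\le a\,m$ (for instance $\tilde m=m$, when $a\ge 1$), the sampling algorithm on $G$ with input $\tilde m$ has the following properties. 1. It returns a perfectly uniform edge: each edge of $G$ is returned with probability exactly $1/m$. More precisely, each ordered pair $(u,v)$ of adjacent vertices is returned with probability exactly $1/(2m)$, and every other pair with probability $0$. 2. Its expected query complexity is at most $C\,n/\sqrt m$. -/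

import Mathlib

open scoped ENNReal

noncomputable section

/-- Randomized algorithms with oracle access and output in `α`. A query `q : Q` is answered by an
element of `A q`. An algorithm returns a value, draws from a distribution of its own, makes a
query, or runs a loop: starting in the state `s`, the loop body is run until it returns some
`Sum.inr b`; a result `Sum.inl s'` means another round from state `s'`. -/
inductive Prog (Q : Type) (A : Q → Type) : Type → Type 1
  | ret {α : Type} (a : α) : Prog Q A α
  | rand {α β : Type} (μ : PMF β) (k : β → Prog Q A α) : Prog Q A α
  | query {α : Type} (q : Q) (k : A q → Prog Q A α) : Prog Q A α
  | loop {α σ β : Type} (body : σ → Prog Q A (σ ⊕ β)) (s : σ) (k : β → Prog Q A α) : Prog Q A α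

namespace Prog

variable {Q : Type} {A : Q → Type}

/-- Sequential composition. -/
def bind {α β : Type} (P : Prog Q A α) (g : α → Prog Q A β) : Prog Q A β :=
  match P with
  | ret a => g a
  | rand μ k => rand μ (fun b => (k b).bind g)
  | query q k => query q (fun r => (k r).bind g)
  | loop body s k => loop body s (fun b => (k b).bind g)

instance : Monad (Prog Q A) where
  pure := ret
  bind := bind

/-- Draw from the distribution `μ`, using internal randomness. -/
def sample {β : Type} (μ : PMF β) : Prog Q A β := rand μ ret

/-- Make the query `q` and return the answer. -/
def ask (q : Q) : Prog Q A (A q) := query q ret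

/-- Run `P` again and again until it returns `some a`; then return `a`. -/
def repeatUntil {α : Type} (P : Prog Q A (Option α)) : Prog Q A α :=
  loop (fun _ : Unit => P.bind fun r =>
    match r with
    | none => ret (Sum.inl ())
    | some a => ret (Sum.inr a)) () ret

/-- Run `P`, answering each query `q` of `P` by a fresh run of the subroutine `g q`. -/
def substQuery {Q' : Type} {A' : Q' → Type} {α : Type} (g : ∀ q, Prog Q' A' (A q))
    (P : Prog Q A α) : Prog Q' A' α :=
  match P with
  | ret a => ret a
  | rand μ k => rand μ (fun b => (k b).substQuery g)
  | query q k => (g q).bind (fun r => (k r).substQuery g)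
  | loop body s k =>
      loop (fun s' => (body s').substQuery g) s (fun b => (k b).substQuery g)

/-- `ev O c P f` is the expected value of `c * (number of queries made) + f (output)` in a run of
`P`, where each query `q` is answered by an independent draw from `O q` and where the term
`f (output)` counts as `0` if the run does not halt. The value of a loop is the limit of the values
of its truncations to at most `N` rounds (a truncated run counts as not halting). -/
def ev (O : ∀ q, PMF (A q)) (c : ℝ≥0∞) {α : Type} (P : Prog Q A α) (f : α → ℝ≥0∞) : ℝ≥0∞ :=
  match P with
  | ret a => f a
  | rand μ k => ∑' b, μ b * ev O c (k b) f
  | query q k => c + ∑' r, O q r * ev O c (k r) f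
  | loop body s k =>
      ⨆ N : ℕ, (fun X s' => ev O c (body s') (Sum.elim X (fun b => ev O c (k b) f)))^[N]
        (fun _ => 0) s

/-- The probability that `P` halts with an output in `S`. -/
def prob (O : ∀ q, PMF (A q)) {α : Type} (P : Prog Q A α) (S : Set α) : ℝ≥0∞ :=
  ev O 0 P (S.indicator 1)

/-- The expected number of queries that `P` makes (over the whole run, halting or not). -/
def expectedQueries (O : ∀ q, PMF (A q)) {α : Type} (P : Prog Q A α) : ℝ≥0∞ :=
  ev O 1 P 0

end Prog

/-- A uniformly random element of `{0, …, k - 1}` (and `0` if `k = 0`). -/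
def uniformBelow (k : ℕ) : PMF ℕ :=
  if h : 0 < k then PMF.uniformOfFinset (Finset.range k) ⟨0, Finset.mem_range.mpr h⟩
  else PMF.pure 0

/-- The distribution `Bern(p)` on bits: `true` has probability `p`. -/
def bern (p : NNReal) (hp : p ≤ 1) : PMF Bool :=
  PMF.ofFintype (fun b => if b = true then (p : ℝ≥0∞) else 1 - (p : ℝ≥0∞)) <| by
    have h : (p : ℝ≥0∞) ≤ 1 := by exact_mod_cast hp
    simp [add_tsub_cancel_of_le h]

theorem one_third_le_one : (1 / 3 : NNReal) ≤ 1 := by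
  rw [div_le_one (by norm_num)]
  norm_num

/-- Algorithms with access to a coin and with output a bit: the only query is a coin flip. -/
abbrev CoinProg : Type 1 := Prog Unit (fun _ => Bool) Bool

/-- The coin that shows `true` with probability `p`; its flips are independent. -/
def coin (p : NNReal) (hp : p ≤ 1) : Unit → PMF Bool := fun _ => bern p hp

/-- `F` is a Bernoulli factory for `p ↦ 1 / (2 p)` on `[2/3, 1]`: it does not know `p`, it flips a
`Bern(p)` coin a number of times with expectation bounded uniformly in `p`, and it
outputs a bit with distribution `Bern(1 / (2 p))`. -/
def IsInvTwoFactory (F : CoinProg) : Prop :=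
  (∀ (p : NNReal) (hp : p ≤ 1), 2 / 3 ≤ p →
    F.prob (coin p hp) {true} = ENNReal.ofReal (1 / (2 * (p : ℝ))) ∧
    F.prob (coin p hp) {false} = ENNReal.ofReal (1 - 1 / (2 * (p : ℝ)))) ∧
  ∃ K : NNReal, ∀ (p : NNReal) (hp : p ≤ 1), 2 / 3 ≤ p →
    F.expectedQueries (coin p hp) ≤ K

/-- The queries of the indexed neighbor access model (labels are counted from `0`). -/
inductive GraphQuery (V : Type) : Type
  | vertex (i : ℕ)
  | degree (v : V)
  | neighbor (v : V) (j : ℕ)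

/-- The type of answers; the answer `none` is given for a label out of range. -/
def GraphQuery.Ans {V : Type} : GraphQuery V → Type
  | .vertex _ => Option V
  | .degree _ => ℕ
  | .neighbor _ _ => Option V

/-- Algorithms with query access to a graph on the vertex set `V`. -/
abbrev GraphProg (V : Type) : Type → Type 1 := Prog (GraphQuery V) GraphQuery.Ans

/-- Arbitrary labellings of the vertices of `G` by `n` labels, and of the edges at each vertex `v`
(that is, of the neighbors of `v`) by `d(v)` labels. -/
structure IndexedAccess {V : Type} [Fintype V] (G : SimpleGraph V) [DecidableRel G.Adj] where
  vertexLabel : Fin (Fintype.card V) ≃ V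
  neighborLabel : ∀ v : V, Fin (G.degree v) ≃ G.neighborSet v

/-- The answers to the queries about `G`. -/
def IndexedAccess.answer {V : Type} [Fintype V] {G : SimpleGraph V} [DecidableRel G.Adj]
    (L : IndexedAccess G) : ∀ q : GraphQuery V, q.Ans
  | .vertex i => if h : i < Fintype.card V then some (L.vertexLabel ⟨i, h⟩) else none
  | .degree v => G.degree v
  | .neighbor v j => if h : j < G.degree v then some (L.neighborLabel v ⟨j, h⟩ : V) else none

/-- The (deterministic) oracle for `G`. -/
def IndexedAccess.oracle {V : Type} [Fintype V] {G : SimpleGraph V} [DecidableRel G.Adj]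
    (L : IndexedAccess G) (q : GraphQuery V) : PMF q.Ans := PMF.pure (L.answer q)

section Algorithms

variable {V : Type}

def askVertex (i : ℕ) : GraphProg V (Option V) := Prog.ask (GraphQuery.vertex i)

def askDegree (v : V) : GraphProg V ℕ := Prog.ask (GraphQuery.degree v)

def askNeighbor (v : V) (j : ℕ) : GraphProg V (Option V) := Prog.ask (GraphQuery.neighbor v j)

/-- A uniformly random neighbor of `v` (`none` only if `v` is isolated). -/
def randomNeighbor (v : V) : GraphProg V (Option V) := do
  let d ← askDegree v
  let j ← Prog.sample (uniformBelow d)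
  askNeighbor v j

/-- One attempt at sampling an edge in a graph on `n` vertices, with degree threshold `θ`: a vertex
is light if its degree is at most `θ` and heavy otherwise. The result `none` means failure.
(The branches for `none` answers of the oracle are never taken.) -/
def tryEdge (n θ : ℕ) : GraphProg V (Option (V × V)) := do
  let i ← Prog.sample (uniformBelow n)
  let some u ← askVertex i | return none
  let j ← Prog.sample (uniformBelow θ)
  let d ← askDegree u
  if d > θ ∨ d ≤ j then
    return none
  else
    let some v ← askNeighbor u j | return none
    let B ← Prog.sample (bern (1 / 3) one_third_le_one)
    if B = true then
      return some (u, v)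
    else
      let d' ← askDegree v
      if d' > θ then
        let some w ← randomNeighbor v | return none
        return some (v, w)
      else
        return none

/-- The trial whether a uniformly random neighbor of `v` is light. -/
def lightNeighborTrial (θ : ℕ) (v : V) : GraphProg V Bool := do
  let some w ← randomNeighbor v | return false
  let d ← askDegree w
  return decide (d ≤ θ)

/-- One round: attempt to sample an edge `vw`. If `v` is light, keep the edge. If `v` is heavy, run
the Bernoulli factory `F` on the trials whether a random neighbor of `v` is light, and keep the
edge if and only if the outcome of `F` is `true`. -/
def edgeRound (F : CoinProg) (n θ : ℕ) : GraphProg V (Option (V × V)) := do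
  let some (v, w) ← tryEdge n θ | return none
  let d ← askDegree v
  if d ≤ θ then
    return some (v, w)
  else
    let Y ← Prog.substQuery (fun _ => lightNeighborTrial θ v) F
    if Y = true then
      return some (v, w)
    else
      return none

/-- The edge sampling algorithm for a graph on `n` vertices, given the estimate `mt` of the number
of edges: repeat rounds with threshold `⌈√(6 mt)⌉` until one of them returns an edge. -/
def sampleEdge (F : CoinProg) (n : ℕ) (mt : ℝ) : GraphProg V (V × V) :=
  Prog.repeatUntil (edgeRound F n ⌈√(6 * mt)⌉₊)

end Algorithms

end

/-!
Put `α = 1 / (3 n θ)`. An attempt returns the ordered pair `vw` with probability `α` if `v` is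
light, and with probability `2 p(v) α` if `v` is heavy, where `p(v)` is the fraction of light
neighbors of `v`: it must reach `v` from a light neighbor, and `B = 0` is twice as likely as
`B = 1`. As `6 m ≤ θ²`, a heavy vertex has `p(v) ≥ 2 / 3`, so accepting its pairs with probability
`1 / (2 p(v))` gives every ordered pair the same probability `α`. A round thus succeeds with
probability `2 m α`, and `O(1 / (m α)) = O(n θ / m) = O(n / √m)` queries suffice in expectation.

For the factory put `q = 1 - p ≤ 1 / 3`, so that `1 / (2 p) = ∑ i, (2 q) ^ i / 2 ^ (i + 1)`. A walk
that goes up with probability `1 / (c + 1)`, and otherwise goes down if a trial fails, hits `0` from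
height `i` with probability `(c q) ^ i` as long as `c q < 1`. It drifts upwards, so with `c = 2`
alone it may escape to infinity and never halt. At exponentially growing heights `i` the walk is
therefore killed, surviving only with probability `(c / c') ^ i`, and goes on with a slightly larger
rate `c'`: this preserves `(c q) ^ i`, and as the rates stay below `5 / 2` the drift stays positive.
-/

theorem one_le_of_forall_natCast_le_mul_add {x t : ℝ≥0∞} (ht : t ≠ ∞)
    (h : ∀ N : ℕ, (N : ℝ≥0∞) ≤ N * x + t) : 1 ≤ x := by
  by_contra! hx
  lift x to NNReal using hx.ne_top
  lift t to NNReal using ht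
  have hx' : (x : ℝ) < 1 := by exact_mod_cast hx
  obtain ⟨N, hN⟩ := exists_nat_gt ((t : ℝ) / (1 - x))
  have hle : (N : ℝ) ≤ N * x + t := by exact_mod_cast h N
  rw [div_lt_iff₀ (by linarith)] at hN
  linarith

namespace Prog

variable {Q : Type} {A : Q → Type} (O : ∀ q, PMF (A q)) (c : ℝ≥0∞) {α β σ : Type}

theorem pure_eq (a : α) : (pure a : Prog Q A α) = ret a := rfl

theorem bind_eq (P : Prog Q A α) (g : α → Prog Q A β) : (P >>= g) = P.bind g := rfl

theorem ev_ret (a : α) (f : α → ℝ≥0∞) : ev O c (ret a) f = f a := by simp only [ev]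

theorem ev_rand (μ : PMF β) (k : β → Prog Q A α) (f : α → ℝ≥0∞) :
    ev O c (rand μ k) f = ∑' b, μ b * ev O c (k b) f := by simp only [ev]

theorem ev_query (q : Q) (k : A q → Prog Q A α) (f : α → ℝ≥0∞) :
    ev O c (query q k) f = c + ∑' r, O q r * ev O c (k r) f := by simp only [ev]

theorem ev_sample (μ : PMF β) (f : β → ℝ≥0∞) : ev O c (sample μ) f = ∑' b, μ b * f b := by
  simp only [sample, ev]

theorem ev_ask (q : Q) (f : A q → ℝ≥0∞) : ev O c (ask q) f = c + ∑' r, O q r * f r := by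
  simp only [ask, ev]

/-- The operator on state values whose iterates define the value of a loop: `loopStep O c body h X`
is the value of one round of the loop when states are worth `X` and results are worth `h`. -/
noncomputable def loopStep (body : σ → Prog Q A (σ ⊕ β)) (h : β → ℝ≥0∞) (X : σ → ℝ≥0∞) (s : σ) :
    ℝ≥0∞ :=
  ev O c (body s) (Sum.elim X h)

theorem ev_loop (body : σ → Prog Q A (σ ⊕ β)) (s : σ) (k : β → Prog Q A α) (f : α → ℝ≥0∞) :
    ev O c (loop body s k) f =
      ⨆ N : ℕ, (loopStep O c body fun b => ev O c (k b) f)^[N] (fun _ => 0) s := by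
  rw [ev]; rfl

theorem ev_bind (P : Prog Q A α) (g : α → Prog Q A β) (f : β → ℝ≥0∞) :
    ev O c (P.bind g) f = ev O c P fun a => ev O c (g a) f := by
  induction P with
  | ret a => simp only [Prog.bind, ev]
  | rand μ k ih => simp only [Prog.bind, ev, ih]
  | query q k ih => simp only [Prog.bind, ev, ih]
  | loop body s k _ ih => simp only [Prog.bind, ev, ih]

theorem ev_mono (P : Prog Q A α) : Monotone (ev O c P) := by
  intro f g hfg
  induction P with
  | ret a => simpa only [ev] using hfg a
  | rand μ k ih =>
    simp only [ev]
    gcongr with b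
    exact ih b hfg
  | query q k ih =>
    simp only [ev]
    gcongr with b
    exact ih b hfg
  | loop body s k ihb ih =>
    rw [ev_loop, ev_loop]
    refine iSup_mono fun N => ?_
    induction N generalizing s with
    | zero => exact le_rfl
    | succ N ihN =>
      rw [Function.iterate_succ_apply', Function.iterate_succ_apply']
      exact ihb s (Sum.elim_le_elim_iff.mpr ⟨ihN, fun b => ih b hfg⟩)

theorem loopStep_mono (body : σ → Prog Q A (σ ⊕ β)) (h : β → ℝ≥0∞) :
    Monotone (loopStep O c body h) := fun _ _ hXY s =>
  ev_mono O c (body s) (Sum.elim_le_elim_iff.mpr ⟨hXY, le_rfl⟩)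

theorem monotone_iterate_loopStep (body : σ → Prog Q A (σ ⊕ β)) (h : β → ℝ≥0∞) (s : σ) :
    Monotone fun N : ℕ => (loopStep O c body h)^[N] (fun _ => 0) s := fun _ _ hMN =>
  (loopStep_mono O c body h).monotone_iterate_of_le_map (fun _ => zero_le) hMN s

theorem ev_add (P : Prog Q A α) (f g : α → ℝ≥0∞) :
    ev O c P (f + g) = ev O c P f + ev O 0 P g := by
  induction P with
  | ret a => simp only [ev, Pi.add_apply]
  | rand μ k ih => simp only [ev, ih, mul_add, ENNReal.tsum_add]
  | query q k ih => simp only [ev, ih, mul_add, ENNReal.tsum_add, zero_add, add_assoc]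
  | loop body s k ihb ih =>
    rw [ev_loop, ev_loop, ev_loop, ENNReal.iSup_add_iSup_of_monotone
      (monotone_iterate_loopStep O c body _ s) (monotone_iterate_loopStep O 0 body _ s)]
    refine iSup_congr fun N => ?_
    induction N generalizing s with
    | zero => simp
    | succ N ihN =>
      simp only [Function.iterate_succ_apply']
      rw [loopStep, loopStep, loopStep, ← ihb]
      congr 1
      funext x
      cases x with
      | inl x => exact ihN x
      | inr b => exact ih b f g

theorem ev_mul (a : ℝ≥0∞) (P : Prog Q A α) (f : α → ℝ≥0∞) :
    ev O (a * c) P (fun x => a * f x) = a * ev O c P f := by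
  induction P with
  | ret b => simp only [ev]
  | rand μ k ih => simp only [ev, ih, ← ENNReal.tsum_mul_left, mul_left_comm]
  | query q k ih => simp only [ev, ih, mul_add, ← ENNReal.tsum_mul_left, mul_left_comm]
  | loop body s k ihb ih =>
    rw [ev_loop, ev_loop, ENNReal.mul_iSup]
    refine iSup_congr fun N => ?_
    induction N generalizing s with
    | zero => simp
    | succ N ihN =>
      simp only [Function.iterate_succ_apply']
      rw [loopStep, loopStep, ← ihb]
      congr 1
      funext x
      cases x with
      | inl x => exact ihN x
      | inr b => exact ih b f

theorem ev_zero_mul (a : ℝ≥0∞) (P : Prog Q A α) (f : α → ℝ≥0∞) :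
    ev O 0 P (fun x => a * f x) = a * ev O 0 P f := by
  simpa only [mul_zero] using ev_mul O 0 a P f

theorem ev_eq_mul_expectedQueries_add (P : Prog Q A α) (f : α → ℝ≥0∞) :
    ev O c P f = c * P.expectedQueries O + ev O 0 P f := by
  rw [expectedQueries, ← ev_mul, ← ev_add, mul_one]
  congr 1
  funext a
  simp

theorem ev_substQuery {Q' : Type} {A' : Q' → Type} (O' : ∀ q, PMF (A' q)) {c c' : ℝ≥0∞}
    {g : ∀ q, Prog Q' A' (A q)} (hg : ∀ q f, ev O' c' (g q) f = c + ∑' r, O q r * f r)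
    (P : Prog Q A α) (f : α → ℝ≥0∞) :
    ev O' c' (P.substQuery g) f = ev O c P f := by
  induction P with
  | ret a => simp only [substQuery, ev]
  | rand μ k ih => simp only [substQuery, ev, ih]
  | query q k ih => simp only [substQuery, ev, ev_bind, hg, ih]
  | loop body s k ihb ih => simp only [substQuery, ev, ihb, ih]

theorem ev_loop_le_of_supersolution (body : σ → Prog Q A (σ ⊕ β)) (k : β → Prog Q A α)
    (f : α → ℝ≥0∞) (X : σ → ℝ≥0∞)
    (hX : ∀ s, ev O c (body s) (Sum.elim X fun b => ev O c (k b) f) ≤ X s) (s : σ) :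
    ev O c (loop body s k) f ≤ X s := by
  rw [ev_loop]
  refine iSup_le fun N => ?_
  suffices h : (loopStep O c body fun b => ev O c (k b) f)^[N] (fun _ => 0) ≤ X from h s
  induction N with
  | zero => exact fun _ => zero_le
  | succ N ihN =>
    rw [Function.iterate_succ_apply']
    exact (loopStep_mono O c body _ ihN).trans hX

theorem ev_zero_one_le (P : Prog Q A α) : ev O 0 P 1 ≤ 1 := by
  induction P with
  | ret _ => simp only [ev, Pi.one_apply, le_refl]
  | rand μ k ih =>
    rw [ev_rand, ← μ.tsum_coe]
    gcongr with b
    exact mul_le_of_le_one_right' (ih b)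
  | query q k ih =>
    rw [ev_query, zero_add, ← (O q).tsum_coe]
    gcongr with b
    exact mul_le_of_le_one_right' (ih b)
  | loop body s k ihb ih =>
    refine ev_loop_le_of_supersolution O 0 body k _ 1 (fun s => ?_) s
    exact (ev_mono O 0 _ (Sum.elim_le_one_iff.mpr ⟨le_rfl, ih⟩)).trans (ihb s)

/-- Supersolutions only bound the value of a loop from above, but two complementary ones are both
exact once the loop halts. -/
theorem ev_loop_eq_of_add_eq_one (body : σ → Prog Q A (σ ⊕ β)) (f g : β → ℝ≥0∞)
    (X Y : σ → ℝ≥0∞) (hfg : f + g = 1) (hXY : X + Y = 1)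
    (hX : ∀ s, ev O 0 (body s) (Sum.elim X f) ≤ X s)
    (hY : ∀ s, ev O 0 (body s) (Sum.elim Y g) ≤ Y s)
    (s : σ) (hhalts : ev O 0 (loop body s ret) 1 = 1) :
    ev O 0 (loop body s ret) f = X s := by
  have hf := ev_loop_le_of_supersolution O 0 body ret f X (by simpa only [ev_ret] using hX) s
  have hg := ev_loop_le_of_supersolution O 0 body ret g Y (by simpa only [ev_ret] using hY) s
  have hXYs : X s + Y s = 1 := congrFun hXY s
  have hYs : Y s ≠ ∞ := ne_top_of_le_ne_top ENNReal.one_ne_top (hXYs ▸ le_add_self)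
  refine le_antisymm hf ((ENNReal.add_le_add_iff_right hYs).mp ?_)
  calc X s + Y s = ev O 0 (loop body s ret) (f + g) := by rw [hXYs, hfg, hhalts]
    _ = ev O 0 (loop body s ret) f + ev O 0 (loop body s ret) g := ev_add O 0 _ f g
    _ ≤ ev O 0 (loop body s ret) f + Y s := by gcongr

theorem ev_repeatUntil (P : Prog Q A (Option α)) (f : α → ℝ≥0∞) :
    ev O c (repeatUntil P) f =
      ev O c P (fun r => r.elim 0 f) * (1 - ev O 0 P fun r => r.elim 1 0)⁻¹ := by
  set x := ev O c P fun r => r.elim 0 f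
  set p := ev O 0 P fun r => r.elim 1 0 with hp
  have hround (y : ℝ≥0∞) : ev O c P (fun r => r.elim y f) = y * p + x := by
    rw [hp, ← ev_zero_mul, add_comm, ← ev_add]
    congr 1
    funext r
    cases r <;> simp
  rw [repeatUntil, ev_loop, ← ENNReal.tsum_geometric, ← ENNReal.tsum_mul_left,
    ENNReal.tsum_eq_iSup_nat]
  refine iSup_congr fun N => ?_
  induction N with
  | zero => simp
  | succ N ih =>
    rw [Function.iterate_succ_apply', Finset.sum_range_succ', loopStep, ev_bind]
    simp only [pow_succ, ← mul_assoc, ← Finset.sum_mul, pow_zero, mul_one, ← ih, ← hround]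
    congr 1
    funext r
    cases r <;> simp only [ev_ret, Sum.elim_inl, Sum.elim_inr, Option.elim]

theorem ev_repeatUntil_of_halts {P : Prog Q A (Option α)} (hP : ev O 0 P 1 = 1) (f : α → ℝ≥0∞) :
    ev O c (repeatUntil P) f =
      ev O c P (fun r => r.elim 0 f) / ev O 0 P fun r => r.elim 0 1 := by
  have hadd : (ev O 0 P fun r => r.elim 0 1) + (ev O 0 P fun r => r.elim 1 0) = 1 := by
    rw [← ev_add]
    convert hP using 2
    funext r
    cases r <;> simp
  have hfail : (ev O 0 P fun r => r.elim 1 0) ≠ ∞ :=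
    ne_top_of_le_ne_top ENNReal.one_ne_top (le_add_self.trans hadd.le)
  rw [ev_repeatUntil, ← ENNReal.eq_sub_of_add_eq hfail hadd, div_eq_mul_inv]

theorem ev_bool (P : Prog Q A Bool) (f : Bool → ℝ≥0∞) :
    ev O 0 P f = P.prob O {true} * f true + P.prob O {false} * f false := by
  rw [prob, prob, mul_comm, mul_comm _ (f false), ← ev_zero_mul, ← ev_zero_mul, ← ev_add]
  congr 1
  funext b
  cases b <;> simp

theorem prob_true_add_prob_false (P : Prog Q A Bool) :
    P.prob O {true} + P.prob O {false} = ev O 0 P 1 := by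
  simp only [ev_bool, Pi.one_apply, mul_one]

/-- `P` halts almost surely, after at most `a` queries in expectation. -/
structure HaltsWithin (P : Prog Q A α) (a : ℝ≥0∞) : Prop where
  ev_one : ev O 0 P 1 = 1
  expectedQueries_le : P.expectedQueries O ≤ a

namespace HaltsWithin

variable {O} {a b : ℝ≥0∞} {P : Prog Q A α}

theorem mono (hP : HaltsWithin O P a) (hab : a ≤ b) : HaltsWithin O P b :=
  ⟨hP.ev_one, hP.expectedQueries_le.trans hab⟩

theorem ev_const (hP : HaltsWithin O P a) (x : ℝ≥0∞) : ev O 0 P (fun _ => x) = x := by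
  have h := ev_zero_mul O x P 1
  simpa only [Pi.one_apply, hP.ev_one, mul_one] using h

theorem ret (x : α) : HaltsWithin O (ret x) 0 :=
  ⟨by rw [ev_ret, Pi.one_apply], by rw [expectedQueries, ev_ret, Pi.zero_apply]⟩

theorem sample (μ : PMF α) : HaltsWithin O (sample μ) 0 :=
  ⟨by simp [ev_sample], by simp [expectedQueries, ev_sample]⟩

theorem ask (q : Q) : HaltsWithin O (ask q) 1 :=
  ⟨by simp [ev_ask], by simp [expectedQueries, ev_ask]⟩

theorem bind (hP : HaltsWithin O P a) {g : α → Prog Q A β} (hg : ∀ x, HaltsWithin O (g x) b) :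
    HaltsWithin O (P.bind g) (a + b) where
  ev_one := by simp only [ev_bind, (hg _).ev_one, hP.ev_const]
  expectedQueries_le :=
    calc (P.bind g).expectedQueries O = ev O 1 P fun x => (g x).expectedQueries O := ev_bind O 1 ..
      _ ≤ ev O 1 P fun _ => b := ev_mono O 1 P fun x => (hg x).expectedQueries_le
      _ = P.expectedQueries O + b := by
        rw [ev_eq_mul_expectedQueries_add, one_mul, hP.ev_const]
      _ ≤ a + b := by gcongr; exact hP.expectedQueries_le

theorem substQuery {Q' : Type} {A' : Q' → Type} {O' : ∀ q, PMF (A' q)}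
    {g : ∀ q, Prog Q' A' (A q)} {k : NNReal} (hP : HaltsWithin O P a)
    (hg : ∀ c q f, ev O' c (g q) f = k * c + ∑' r, O q r * f r) :
    HaltsWithin O' (P.substQuery g) (k * a) where
  ev_one := by rw [ev_substQuery O O' (c := 0) fun q f => by rw [hg, mul_zero], hP.ev_one]
  expectedQueries_le := by
    rw [expectedQueries, ev_substQuery O O' (hg 1), ev_eq_mul_expectedQueries_add, mul_one]
    have hzero : ev O 0 P 0 = 0 := hP.ev_const 0
    rw [hzero, add_zero]
    gcongr
    exact hP.expectedQueries_le

theorem expectedQueries_repeatUntil_le {P : Prog Q A (Option α)} (hP : HaltsWithin O P a) :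
    (repeatUntil P).expectedQueries O ≤ a / ev O 0 P fun r => r.elim 0 1 := by
  rw [expectedQueries, ev_repeatUntil_of_halts O 1 hP.ev_one]
  gcongr
  refine le_of_eq_of_le ?_ hP.expectedQueries_le
  rw [expectedQueries]
  congr 1
  funext r
  cases r <;> rfl

end HaltsWithin

section Loop

variable {body : σ → Prog Q A (σ ⊕ β)} {T : σ → ℝ≥0∞}

/-- Markov's inequality for the number of rounds: it exceeds `N` with probability at most
`T s / N`. -/
theorem natCast_le_mul_iterate_loopStep_add (hbody : ∀ s, ev O 0 (body s) 1 = 1)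
    (hT : ∀ s, 1 + ev O 0 (body s) (Sum.elim T 0) ≤ T s) (N : ℕ) (s : σ) :
    (N : ℝ≥0∞) ≤ N * (loopStep O 0 body 1)^[N] (fun _ => 0) s + T s := by
  induction N generalizing s with
  | zero => simp
  | succ N ih =>
    rw [Function.iterate_succ_apply']
    set X := (loopStep O 0 body 1)^[N] (fun _ => 0)
    have hround : (N : ℝ≥0∞) ≤ N * loopStep O 0 body 1 X s + ev O 0 (body s) (Sum.elim T 0) :=
      calc (N : ℝ≥0∞) = ev O 0 (body s) fun _ => N * 1 := by
            rw [ev_zero_mul O N]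
            exact (congrArg _ (hbody s)).trans (mul_one _) |>.symm
        _ ≤ ev O 0 (body s) ((fun x => N * Sum.elim X 1 x) + Sum.elim T 0) := by
            refine ev_mono O 0 _ fun x => ?_
            cases x with
            | inl x => simpa using ih x
            | inr b => simp
        _ = N * loopStep O 0 body 1 X s + ev O 0 (body s) (Sum.elim T 0) := by
            rw [ev_add, ev_zero_mul, loopStep]
    calc ((N + 1 : ℕ) : ℝ≥0∞) = N + 1 := by push_cast; rfl
      _ ≤ N * loopStep O 0 body 1 X s + ev O 0 (body s) (Sum.elim T 0) + 1 := by gcongr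
      _ = N * loopStep O 0 body 1 X s + (1 + ev O 0 (body s) (Sum.elim T 0)) := by ring
      _ ≤ (N + 1 : ℕ) * loopStep O 0 body 1 X s + T s := by
          gcongr
          · exact N.le_succ
          · exact hT s

theorem HaltsWithin.loop {O} {b : ℝ≥0∞} (hbody : ∀ s, HaltsWithin O (body s) b)
    (hT_top : ∀ s, T s ≠ ∞) (hT : ∀ s, 1 + ev O 0 (body s) (Sum.elim T 0) ≤ T s) (s : σ) :
    HaltsWithin O (loop body s Prog.ret) (b * T s) where
  ev_one := by
    refine le_antisymm (ev_zero_one_le O _) ?_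
    refine one_le_of_forall_natCast_le_mul_add (hT_top s) fun N => ?_
    refine (natCast_le_mul_iterate_loopStep_add O (fun s => (hbody s).ev_one) hT N s).trans ?_
    rw [ev_loop]
    gcongr
    exact le_iSup (fun N => (loopStep O 0 body fun b => ev O 0 (Prog.ret b) 1)^[N] (fun _ => 0) s) N
  expectedQueries_le := by
    refine ev_loop_le_of_supersolution O 1 body Prog.ret 0 (fun s => b * T s) (fun s => ?_) s
    have helim : Sum.elim (fun s => b * T s) (fun x : β => ev O 1 (Prog.ret x) 0) =
        fun x => b * Sum.elim T 0 x := by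
      funext x
      cases x <;> simp [ev_ret]
    calc _ = (body s).expectedQueries O + b * ev O 0 (body s) (Sum.elim T 0) := by
          rw [helim, ev_eq_mul_expectedQueries_add, one_mul, ev_zero_mul]
      _ ≤ b * (1 + ev O 0 (body s) (Sum.elim T 0)) := by
          rw [mul_add, mul_one]
          gcongr
          exact (hbody s).expectedQueries_le
      _ ≤ b * T s := by gcongr; exact hT s

end Loop

end Prog

theorem tsum_bern (p : NNReal) (hp : p ≤ 1) (f : Bool → ℝ≥0∞) :
    ∑' b, bern p hp b * f b = p * f true + (1 - p) * f false := by
  rw [tsum_bool, add_comm]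
  simp [bern]

theorem coe_mul_ofReal_add_one_sub_mul_ofReal {p : NNReal} (hp : p ≤ 1) {x y : ℝ} (hx : 0 ≤ x)
    (hy : 0 ≤ y) :
    p * ENNReal.ofReal x + (1 - p) * ENNReal.ofReal y =
      ENNReal.ofReal (p * x + (1 - p) * y) := by
  have hp' : (0 : ℝ) ≤ 1 - p := sub_nonneg.mpr (by exact_mod_cast hp)
  rw [ENNReal.ofReal_add (mul_nonneg p.coe_nonneg hx) (mul_nonneg hp' hy),
    ENNReal.ofReal_mul p.coe_nonneg, ENNReal.ofReal_mul hp', ENNReal.ofReal_sub _ p.coe_nonneg,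
    ENNReal.ofReal_one, ENNReal.ofReal_coe_nnreal]

namespace InvTwoFactory

/-- The multiplier `c` in phase `j` of the walk, whose value at height `i` is `(c * q) ^ i` if `q`
is the probability of `false`. It increases from `2` to the limit `5 / 2`. -/
noncomputable def rate (j : ℕ) : NNReal := 10 * 2 ^ j / (4 * 2 ^ j + 1)

theorem coe_rate (j : ℕ) : (rate j : ℝ) = 10 * 2 ^ j / (4 * 2 ^ j + 1) := by simp [rate]

theorem rate_zero : rate 0 = 2 := by
  ext
  norm_num [coe_rate]

theorem rate_pos (j : ℕ) : 0 < rate j := by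
  rw [rate]
  positivity

theorem rate_le (j : ℕ) : rate j ≤ 5 / 2 := by
  rw [← NNReal.coe_le_coe, coe_rate]
  push_cast
  rw [div_le_div_iff₀ (by positivity) (by positivity)]
  linarith

theorem coe_rate_div_rate_succ (j : ℕ) :
    ((rate j / rate (j + 1) : NNReal) : ℝ) = (8 * 2 ^ j + 1) / (8 * 2 ^ j + 2) := by
  push_cast
  rw [coe_rate, coe_rate, pow_succ]
  field_simp
  ring

theorem rate_div_rate_succ_le_one (j : ℕ) : rate j / rate (j + 1) ≤ 1 := by
  rw [← NNReal.coe_le_coe, coe_rate_div_rate_succ, NNReal.coe_one,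
    div_le_one (by positivity)]
  linarith

theorem rate_div_rate_succ_pow_le {i j : ℕ} (h : 27 * 2 ^ j ≤ i) :
    ((rate j / rate (j + 1) : NNReal) : ℝ) ^ i ≤ 1 / 4 := by
  have hi : 27 * 2 ^ j ≤ (i : ℝ) := by exact_mod_cast h
  have hj : (1 : ℝ) ≤ 2 ^ j := one_le_pow₀ (by norm_num)
  have hinv : ((rate j / rate (j + 1) : NNReal) : ℝ)⁻¹ = 1 + 1 / (8 * 2 ^ j + 1) := by
    rw [coe_rate_div_rate_succ]
    field_simp
    ring
  have hbernoulli : 1 + i * (1 / (8 * 2 ^ j + 1)) ≤ (1 + 1 / (8 * 2 ^ j + 1) : ℝ) ^ i :=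
    one_add_mul_le_pow (by linarith [show (0 : ℝ) ≤ 1 / (8 * 2 ^ j + 1) by positivity]) i
  have hthree : 3 ≤ i * (1 / (8 * 2 ^ j + 1) : ℝ) := by
    rw [mul_one_div, le_div_iff₀ (by positivity)]
    linarith
  rw [← inv_inv ((rate j / rate (j + 1) : NNReal) : ℝ), hinv, inv_pow, one_div (4 : ℝ)]
  exact inv_anti₀ (by norm_num) (by linarith)

theorem one_div_rate_add_one_le_one (j : ℕ) : 1 / (rate j + 1) ≤ 1 :=
  div_le_one_of_le₀ le_add_self (by positivity)

/-- One round of the walk in the state (phase, height). Height `0` is a win. Below the height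
`27 * 2 ^ j` the height moves by at most one, with expected increase
`(1 - rate j * q) / (rate j + 1)`; from there on the walk either fails or enters the next phase. -/
noncomputable def round : ℕ × ℕ → Prog Unit (fun _ => Bool) (ℕ × ℕ ⊕ Bool)
  | (_, 0) => return .inr true
  | (j, i + 1) =>
    if 27 * 2 ^ j ≤ i + 1 then do
      let survive ← Prog.sample
        (bern ((rate j / rate (j + 1)) ^ (i + 1)) (pow_le_one' (rate_div_rate_succ_le_one j) _))
      return if survive then .inl (j + 1, i + 1) else .inr false
    else do
      let up ← Prog.sample (bern (1 / (rate j + 1)) (one_div_rate_add_one_le_one j))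
      if up then
        return .inl (j, i + 2)
      else
        let trial ← Prog.ask ()
        return .inl (j, if trial then i + 1 else i)

/-- The expected value of one round of the walk if the state `t` afterwards is worth `X t` and the
output `b` is worth `y b`. -/
noncomputable def roundMean (p : NNReal) (X : ℕ × ℕ → ℝ) (y : Bool → ℝ) : ℕ × ℕ → ℝ
  | (_, 0) => y true
  | (j, i + 1) =>
    if 27 * 2 ^ j ≤ i + 1 then
      (rate j / rate (j + 1) : NNReal) ^ (i + 1) * X (j + 1, i + 1) +
        (1 - (rate j / rate (j + 1) : NNReal) ^ (i + 1)) * y false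
    else
      (1 / (rate j + 1) : NNReal) * X (j, i + 2) +
        (1 - (1 / (rate j + 1) : NNReal)) * (p * X (j, i + 1) + (1 - p) * X (j, i))

theorem ev_round {p : NNReal} (hp : p ≤ 1) {X : ℕ × ℕ → ℝ} {y : Bool → ℝ} (hX : 0 ≤ X)
    (hy : 0 ≤ y) (s : ℕ × ℕ) :
    (round s).ev (coin p hp) 0
        (Sum.elim (fun t => ENNReal.ofReal (X t)) fun b => ENNReal.ofReal (y b)) =
      ENNReal.ofReal (roundMean p X y s) := by
  have hp' : (0 : ℝ) ≤ 1 - p := sub_nonneg.mpr (by exact_mod_cast hp)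
  obtain ⟨j, _ | i⟩ := s
  · rfl
  rw [round, roundMean]
  split_ifs
  · simp only [Prog.bind_eq, Prog.pure_eq, Prog.ev_bind, Prog.ev_sample, Prog.ev_ret, tsum_bern,
      if_true, Bool.false_eq_true, if_false, Sum.elim_inl, Sum.elim_inr]
    exact coe_mul_ofReal_add_one_sub_mul_ofReal (pow_le_one' (rate_div_rate_succ_le_one j) _)
      (hX _) (hy _)
  · simp only [Prog.bind_eq, Prog.pure_eq, Prog.ev_bind, Prog.ev_sample, Prog.ev_ask, Prog.ev_ret,
      coin, tsum_bern, if_true, Bool.false_eq_true, if_false, Sum.elim_inl, zero_add]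
    rw [coe_mul_ofReal_add_one_sub_mul_ofReal hp (hX _) (hX _)]
    exact coe_mul_ofReal_add_one_sub_mul_ofReal (one_div_rate_add_one_le_one j) (hX _)
      (add_nonneg (mul_nonneg p.2 (hX _)) (mul_nonneg hp' (hX _)))

theorem roundMean_one_sub (p : NNReal) (X : ℕ × ℕ → ℝ) (y : Bool → ℝ) (s : ℕ × ℕ) :
    roundMean p (1 - X) (1 - y) s = 1 - roundMean p X y s := by
  obtain ⟨j, _ | i⟩ := s <;> simp only [roundMean, Pi.sub_apply, Pi.one_apply]
  split_ifs <;> ring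

theorem round_haltsWithin {p : NNReal} (hp : p ≤ 1) (s : ℕ × ℕ) :
    (round s).HaltsWithin (coin p hp) 1 := by
  obtain ⟨j, _ | i⟩ := s
  · exact (Prog.HaltsWithin.ret _).mono zero_le
  rw [round]
  split_ifs
  · exact ((Prog.HaltsWithin.sample _).bind fun _ => .ret _).mono (by simp)
  · refine ((Prog.HaltsWithin.sample _).bind (b := 1) fun up => ?_).mono (by simp)
    split_ifs
    · exact (Prog.HaltsWithin.ret _).mono zero_le
    · exact ((Prog.HaltsWithin.ask ()).bind fun _ => .ret _).mono (by simp)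

/-- The probability that the walk wins from a given state. -/
noncomputable def value (p : NNReal) (s : ℕ × ℕ) : ℝ := (rate s.1 * (1 - p)) ^ s.2

theorem roundMean_value (p : NNReal) (s : ℕ × ℕ) :
    roundMean p (value p) (fun b => if b then 1 else 0) s = value p s := by
  obtain ⟨j, _ | i⟩ := s
  · simp [roundMean, value]
  have hj : (rate j : ℝ) + 1 ≠ 0 := by positivity
  have hj' : (rate (j + 1) : ℝ) ≠ 0 := by exact_mod_cast (rate_pos (j + 1)).ne'
  simp only [roundMean, value]
  push_cast
  split_ifs
  · rw [← mul_pow, ← mul_assoc, div_mul_cancel₀ _ hj']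
    simp
  · field_simp
    ring

section Bias

variable {p : NNReal} (hp : p ≤ 1) (hp' : 2 / 3 ≤ p)

include hp in
theorem rate_mul_nonneg (j : ℕ) : 0 ≤ rate j * (1 - p : ℝ) :=
  mul_nonneg (rate j).2 (sub_nonneg.mpr (by exact_mod_cast hp))

include hp' in
theorem rate_mul_le (j : ℕ) : rate j * (1 - p : ℝ) ≤ 5 / 6 := by
  have hrate : (rate j : ℝ) ≤ 5 / 2 := by exact_mod_cast rate_le j
  have hp'' : (2 / 3 : ℝ) ≤ p := by exact_mod_cast hp'
  nlinarith [(rate j).2]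

include hp hp' in
theorem value_mem_Icc (s : ℕ × ℕ) : value p s ∈ Set.Icc 0 1 :=
  ⟨pow_nonneg (rate_mul_nonneg hp s.1) _, pow_le_one₀ (rate_mul_nonneg hp s.1)
    ((rate_mul_le hp' s.1).trans (by norm_num))⟩

/-- A bound for the expected number of rounds from a given state. Below the threshold the height
increases in expectation by at least `1 / 21`, which pays for the factor `21`. Entering the next
phase at most doubles the potential, with probability at most `1 / 4`; this costs at most half of
`1136 * 2 ^ j`, so that `1136 * 2 ^ j - 21 * (27 * 2 ^ j)` suffices. -/
noncomputable def potential (s : ℕ × ℕ) : ℝ :=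
  1136 * 2 ^ s.1 - 21 * min (s.2 : ℝ) (27 * 2 ^ s.1)

theorem potential_le (s : ℕ × ℕ) : potential s ≤ 1136 * 2 ^ s.1 := by
  have hmin : (0 : ℝ) ≤ min (s.2 : ℝ) (27 * 2 ^ s.1) := by positivity
  rw [potential]
  linarith

theorem one_le_potential (s : ℕ × ℕ) : 1 ≤ potential s := by
  have hpow : (1 : ℝ) ≤ 2 ^ s.1 := one_le_pow₀ (by norm_num)
  have hmin := min_le_right (s.2 : ℝ) (27 * 2 ^ s.1)
  rw [potential]
  linarith

theorem potential_of_le {i j : ℕ} (h : i ≤ 27 * 2 ^ j) :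
    potential (j, i) = 1136 * 2 ^ j - 21 * i := by
  rw [potential, min_eq_left (by exact_mod_cast h)]

include hp' in
theorem inv_le_drift (j : ℕ) : (1 / 21 : ℝ) ≤ (1 - rate j * (1 - p)) / (rate j + 1) := by
  have hrate : (rate j : ℝ) ≤ 5 / 2 := by exact_mod_cast rate_le j
  rw [div_le_div_iff₀ (by norm_num) (by positivity)]
  linarith [rate_mul_le hp' j]

include hp' in
theorem roundMean_potential_add_one_le (s : ℕ × ℕ) :
    roundMean p potential 0 s + 1 ≤ potential s := by
  obtain ⟨j, _ | i⟩ := s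
  · simpa [roundMean] using one_le_potential (j, 0)
  rw [roundMean]
  split_ifs with hi
  · have hhigh : potential (j, i + 1) = 1136 * 2 ^ j - 21 * (27 * 2 ^ j) := by
      rw [potential, min_eq_right (by exact_mod_cast hi)]
    have hnext : ((rate j / rate (j + 1) : NNReal) : ℝ) ^ (i + 1) * potential (j + 1, i + 1) ≤
        1 / 4 * (1136 * 2 ^ (j + 1)) :=
      mul_le_mul (rate_div_rate_succ_pow_le hi) (potential_le _)
        (zero_le_one.trans (one_le_potential _)) (by norm_num)
    have hpow : (1 : ℝ) ≤ 2 ^ j := one_le_pow₀ (by norm_num)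
    rw [hhigh, Pi.zero_apply, mul_zero, add_zero]
    rw [pow_succ 2] at hnext
    linarith
  · rw [potential_of_le (by lia), potential_of_le (by lia), potential_of_le (by lia)]
    have hdrift := inv_le_drift hp' j
    push_cast
    calc
      _ = 1136 * 2 ^ j - 21 * (i + 1) - 21 * ((1 - rate j * (1 - p : ℝ)) / (rate j + 1)) + 1 := by
          field_simp
          ring
      _ ≤ _ := by linarith

include hp' in
theorem loop_haltsWithin (s : ℕ × ℕ) :
    (Prog.loop round s Prog.ret).HaltsWithin (coin p hp) (ENNReal.ofReal (potential s)) := by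
  have hnonneg : 0 ≤ potential := fun t => zero_le_one.trans (one_le_potential t)
  rw [← one_mul (ENNReal.ofReal _)]
  refine Prog.HaltsWithin.loop (round_haltsWithin hp) (fun _ => ENNReal.ofReal_ne_top)
    (fun t => ?_) s
  have hround : (round t).ev (coin p hp) 0 (Sum.elim (fun t => ENNReal.ofReal (potential t)) 0) =
      ENNReal.ofReal (roundMean p potential 0 t) := by
    rw [← ev_round hp hnonneg le_rfl]
    simp only [Pi.zero_apply, ENNReal.ofReal_zero]
    rfl
  calc 1 + _ = 1 + ENNReal.ofReal (roundMean p potential 0 t) := by rw [hround]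
    _ ≤ 1 + ENNReal.ofReal (potential t - 1) := by
      gcongr
      linarith [roundMean_potential_add_one_le hp' t]
    _ = ENNReal.ofReal (potential t) := by
      rw [← ENNReal.ofReal_one, ← ENNReal.ofReal_add zero_le_one
        (sub_nonneg.mpr (one_le_potential t)), add_sub_cancel]

include hp' in
theorem prob_loop_true (s : ℕ × ℕ) :
    (Prog.loop round s Prog.ret).prob (coin p hp) {true} = ENNReal.ofReal (value p s) := by
  have hvalue := value_mem_Icc hp hp'
  let win : Bool → ℝ := fun b => if b then 1 else 0
  have hwin : ({true} : Set Bool).indicator 1 = fun b => ENNReal.ofReal (win b) := by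
    ext b
    cases b <;> simp [win]
  rw [Prog.prob, hwin]
  refine Prog.ev_loop_eq_of_add_eq_one (coin p hp) round _ (fun b => ENNReal.ofReal (1 - win b))
    (fun t => ENNReal.ofReal (value p t)) (fun t => ENNReal.ofReal (1 - value p t)) ?_ ?_
    (fun t => ?_) (fun t => ?_) s (loop_haltsWithin hp hp' s).ev_one
  · ext b
    cases b <;> simp [win]
  · ext t : 1
    simp [← ENNReal.ofReal_add (hvalue t).1 (sub_nonneg.mpr (hvalue t).2)]
  · rw [ev_round hp (fun t => (hvalue t).1) (by intro b; cases b <;> simp [win]),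
      roundMean_value]
  · have h := ev_round hp (X := 1 - value p) (y := 1 - win) (fun t => sub_nonneg.mpr (hvalue t).2)
      (by intro b; cases b <;> simp [win]) t
    rw [roundMean_one_sub, roundMean_value] at h
    exact h.le

end Bias

/-- The walk started in phase `0` at a height that equals `i` with probability `1 / 2 ^ (i + 1)`. -/
noncomputable def factory : CoinProg := do
  let i ← Prog.sample
    (ProbabilityTheory.geometricMeasure ⟨2⁻¹, by norm_num, by norm_num⟩).toPMF
  Prog.loop round (0, i) Prog.ret

theorem factory_haltsWithin {p : NNReal} (hp : p ≤ 1) (hp' : 2 / 3 ≤ p) :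
    factory.HaltsWithin (coin p hp) 1136 := by
  refine ((Prog.HaltsWithin.sample _).bind fun i => ?_).mono (zero_add _).le
  refine (loop_haltsWithin hp hp' (0, i)).mono (ENNReal.ofReal_le_of_le_toReal ?_)
  simpa using potential_le (0, i)

theorem prob_factory_true {p : NNReal} (hp : p ≤ 1) (hp' : 2 / 3 ≤ p) :
    factory.prob (coin p hp) {true} = ENNReal.ofReal (1 / (2 * (p : ℝ))) := by
  have hp₁ : (p : ℝ) ≤ 1 := by exact_mod_cast hp
  have hp₀ : (2 / 3 : ℝ) ≤ p := by exact_mod_cast hp'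
  have hsum : HasSum (fun i : ℕ => (1 - p : ℝ) ^ i * 2⁻¹) (1 / (2 * p)) := by
    convert! (hasSum_geometric_of_lt_one (r := 1 - (p : ℝ)) (by linarith)
      (by linarith)).mul_right 2⁻¹ using 1
    rw [sub_sub_cancel, one_div, mul_inv_rev]
  rw [← hsum.tsum_eq, ENNReal.ofReal_tsum_of_nonneg
    (fun i => mul_nonneg (pow_nonneg (by linarith) _) (by norm_num)) hsum.summable, factory,
    Prog.prob, Prog.bind_eq, Prog.ev_bind, Prog.ev_sample]
  refine tsum_congr fun i => ?_
  have hpow : (1 - p : ℝ) ^ i * 2⁻¹ = 2⁻¹ ^ i * 2⁻¹ * (2 * (1 - p)) ^ i := by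
    rw [mul_right_comm, ← mul_pow, inv_mul_cancel_left₀ two_ne_zero]
  rw [hpow, ENNReal.ofReal_mul (by positivity)]
  congr 1
  · rw [MeasureTheory.Measure.toPMF_apply, ProbabilityTheory.geometricMeasure_singleton]
    · norm_num
    · exact unitInterval.coe_ne_zero.mp (by norm_num)
  · exact (prob_loop_true hp hp' (0, i)).trans (by rw [value, rate_zero]; rfl)

theorem factory_isInvTwoFactory : IsInvTwoFactory factory := by
  refine ⟨fun p hp hp' => ⟨prob_factory_true hp hp', ?_⟩, 1136,
    fun p hp hp' => (factory_haltsWithin hp hp').expectedQueries_le⟩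
  have hsum := (factory.prob_true_add_prob_false (coin p hp)).trans
    (factory_haltsWithin hp hp').ev_one
  rw [prob_factory_true hp hp'] at hsum
  rw [ENNReal.ofReal_sub _ (by positivity), ENNReal.ofReal_one, ← hsum,
    ENNReal.add_sub_cancel_left ENNReal.ofReal_ne_top]

end InvTwoFactory

theorem IsInvTwoFactory.exists_haltsWithin {F : CoinProg} (hF : IsInvTwoFactory F) :
    ∃ K : NNReal, ∀ (p : NNReal) (hp : p ≤ 1), 2 / 3 ≤ p → F.HaltsWithin (coin p hp) K := by
  obtain ⟨hprob, K, hK⟩ := hF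
  refine ⟨K, fun p hp hp' => ⟨?_, hK p hp hp'⟩⟩
  have hp'' : (2 / 3 : ℝ) ≤ p := by exact_mod_cast hp'
  obtain ⟨htrue, hfalse⟩ := hprob p hp hp'
  have hle : 1 / (2 * (p : ℝ)) ≤ 1 := (div_le_one (by linarith)).mpr (by linarith)
  rw [← Prog.prob_true_add_prob_false, htrue, hfalse,
    ← ENNReal.ofReal_add (by positivity) (sub_nonneg.mpr hle), add_sub_cancel, ENNReal.ofReal_one]

theorem inv_natCast_mul_natCast {k : ℕ} (hk : 0 < k) : (k : ℝ≥0∞)⁻¹ * k = 1 :=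
  ENNReal.inv_mul_cancel (by exact_mod_cast hk.ne') (ENNReal.natCast_ne_top k)

theorem tsum_uniformBelow {k : ℕ} (hk : 0 < k) (f : ℕ → ℝ≥0∞) :
    ∑' i, uniformBelow k i * f i = (k : ℝ≥0∞)⁻¹ * ∑ i ∈ Finset.range k, f i := by
  have hne : (Finset.range k).Nonempty := Finset.nonempty_range_iff.mpr hk.ne'
  have huniform : uniformBelow k = PMF.uniformOfFinset (Finset.range k) hne := dif_pos hk
  rw [huniform, Finset.mul_sum, tsum_eq_sum (s := Finset.range k)]
  · refine Finset.sum_congr rfl fun i hi => ?_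
    rw [PMF.uniformOfFinset_apply_of_mem _ hi, Finset.card_range]
  · intro i hi
    rw [PMF.uniformOfFinset_apply_of_notMem _ hi, zero_mul]

theorem sum_range_ite_lt_or_le (θ d : ℕ) (x : ℕ → ℝ≥0∞) :
    ∑ j ∈ Finset.range θ, (if d > θ ∨ d ≤ j then 0 else x j) =
      if d ≤ θ then ∑ j ∈ Finset.range d, x j else 0 := by
  split_ifs with hd
  · rw [← Finset.sum_subset (Finset.range_subset_range.mpr hd)]
    · refine Finset.sum_congr rfl fun j hj => if_neg ?_
      have := Finset.mem_range.mp hj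
      lia
    · intro j _ hj
      exact if_pos (Or.inr (not_lt.mp (mt Finset.mem_range.mpr hj)))
  · exact Finset.sum_eq_zero fun j _ => if_pos (Or.inl (not_le.mp hd))

theorem tsum_bern_one_third (f : Bool → ℝ≥0∞) :
    ∑' b, bern (1 / 3) one_third_le_one b * f b = 3⁻¹ * (f true + 2 * f false) := by
  have hcoe : ((1 / 3 : NNReal) : ℝ≥0∞) = 3⁻¹ := by
    rw [one_div, ENNReal.coe_inv (by norm_num), ENNReal.coe_ofNat]
  have hsub : (1 : ℝ≥0∞) - 3⁻¹ = 3⁻¹ * 2 := by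
    refine ENNReal.sub_eq_of_eq_add (by simp) ?_
    rw [← mul_add_one, two_add_one_eq_three, ENNReal.inv_mul_cancel (by norm_num) (by norm_num)]
  rw [tsum_bern, hcoe, hsub, mul_add, mul_assoc]

section Graph

variable {V : Type} [Fintype V] {G : SimpleGraph V} [DecidableRel G.Adj]

section Queries

variable (L : IndexedAccess G) (c : ℝ≥0∞)

theorem ev_ask_oracle (q : GraphQuery V) (f : q.Ans → ℝ≥0∞) :
    (Prog.ask q).ev L.oracle c f = c + f (L.answer q) := by
  rw [Prog.ev_ask, IndexedAccess.oracle, tsum_eq_single (L.answer q)]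
  · simp
  · intro r hr
    simp [hr]

theorem ev_askDegree (v : V) (f : ℕ → ℝ≥0∞) :
    (askDegree v).ev L.oracle c f = c + f (G.degree v) :=
  ev_ask_oracle L c (.degree v) f

theorem sum_ev_askVertex (f : Option V → ℝ≥0∞) :
    ∑ i ∈ Finset.range (Fintype.card V), (askVertex i).ev L.oracle c f = ∑ u, (c + f (some u)) := by
  rw [Finset.sum_range, ← Equiv.sum_comp L.vertexLabel]
  refine Finset.sum_congr rfl fun i _ => (ev_ask_oracle L c (.vertex i) f).trans ?_
  simp [IndexedAccess.answer]

theorem sum_ev_askNeighbor (v : V) (f : Option V → ℝ≥0∞) :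
    ∑ j ∈ Finset.range (G.degree v), (askNeighbor v j).ev L.oracle c f =
      ∑ w ∈ G.neighborFinset v, (c + f (some w)) := by
  rw [Finset.sum_range, Finset.sum_subtype (G.neighborFinset v) (p := (· ∈ G.neighborSet v))
    (by simp), ← Equiv.sum_comp (L.neighborLabel v)]
  refine Finset.sum_congr rfl fun j _ => (ev_ask_oracle L c (.neighbor v j) f).trans ?_
  simp [IndexedAccess.answer]

variable {v : V} (hv : 0 < G.degree v)
include hv

theorem ev_randomNeighbor (f : Option V → ℝ≥0∞) :
    (randomNeighbor v).ev L.oracle c f =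
      2 * c + (G.degree v : ℝ≥0∞)⁻¹ * ∑ w ∈ G.neighborFinset v, f (some w) := by
  simp only [randomNeighbor, Prog.bind_eq, Prog.ev_bind, Prog.ev_sample, ev_askDegree]
  rw [tsum_uniformBelow hv, sum_ev_askNeighbor, Finset.sum_add_distrib, Finset.sum_const,
    G.card_neighborFinset_eq_degree, nsmul_eq_mul, mul_add, ← mul_assoc,
    inv_natCast_mul_natCast hv]
  ring

end Queries

/-- The fraction of light vertices (those of degree at most `θ`) among the neighbors of `v`. -/
noncomputable def lightFraction (G : SimpleGraph V) [DecidableRel G.Adj] (θ : ℕ) (v : V) : NNReal :=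
  ((G.neighborFinset v).filter fun w => G.degree w ≤ θ).card / G.degree v

theorem card_light_add_card_heavy (θ : ℕ) (v : V) :
    ((G.neighborFinset v).filter fun w => G.degree w ≤ θ).card +
      ((G.neighborFinset v).filter fun w => ¬ G.degree w ≤ θ).card = G.degree v := by
  rw [Finset.card_filter_add_card_filter_not, G.card_neighborFinset_eq_degree]

theorem lightFraction_le_one (θ : ℕ) (v : V) : lightFraction G θ v ≤ 1 := by
  refine div_le_one_of_le₀ ?_ zero_le
  exact_mod_cast (card_light_add_card_heavy θ v).le.trans' le_self_add

theorem coe_lightFraction (θ : ℕ) {v : V} (hv : 0 < G.degree v) :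
    (lightFraction G θ v : ℝ≥0∞) = (G.degree v : ℝ≥0∞)⁻¹ *
      ((G.neighborFinset v).filter fun w => G.degree w ≤ θ).card := by
  rw [lightFraction, ENNReal.coe_div (by exact_mod_cast hv.ne'), ENNReal.div_eq_inv_mul,
    ENNReal.coe_natCast, ENNReal.coe_natCast]

theorem one_sub_lightFraction (θ : ℕ) {v : V} (hv : 0 < G.degree v) :
    1 - (lightFraction G θ v : ℝ≥0∞) = (G.degree v : ℝ≥0∞)⁻¹ *
      ((G.neighborFinset v).filter fun w => ¬ G.degree w ≤ θ).card := by
  refine ENNReal.sub_eq_of_eq_add ENNReal.coe_ne_top ?_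
  rw [coe_lightFraction θ hv, ← mul_add, ← Nat.cast_add, add_comm, card_light_add_card_heavy,
    inv_natCast_mul_natCast hv]

theorem ev_lightNeighborTrial (L : IndexedAccess G) (c : ℝ≥0∞) (θ : ℕ) {v : V}
    (hv : 0 < G.degree v) (f : Bool → ℝ≥0∞) :
    (lightNeighborTrial θ v).ev L.oracle c f =
      3 * c + ∑' b, coin (lightFraction G θ v) (lightFraction_le_one θ v) () b * f b := by
  have hdecide (w : V) : f (decide (G.degree w ≤ θ)) =
      if G.degree w ≤ θ then f true else f false := by
    split_ifs with hw <;> simp [hw]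
  have hsum : ∑ w ∈ G.neighborFinset v, (c + f (decide (G.degree w ≤ θ))) =
      G.degree v * c + (((G.neighborFinset v).filter fun w => G.degree w ≤ θ).card * f true +
        ((G.neighborFinset v).filter fun w => ¬ G.degree w ≤ θ).card * f false) := by
    simp only [hdecide, Finset.sum_add_distrib, Finset.sum_ite, Finset.sum_const, nsmul_eq_mul,
      G.card_neighborFinset_eq_degree]
  simp only [lightNeighborTrial, Prog.bind_eq, Prog.pure_eq, Prog.ev_bind, ev_randomNeighbor L c hv,
    ev_askDegree, Prog.ev_ret]
  rw [hsum, coin, tsum_bern, one_sub_lightFraction θ hv, coe_lightFraction θ hv, mul_add, mul_add,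
    ← mul_assoc, inv_natCast_mul_natCast hv]
  ring

/-- The heavy neighbors of `v` have total degree at most `2m`, so there are fewer than `2m / θ` of
them, which is at most `θ / 3`. -/
theorem two_thirds_le_lightFraction {θ : ℕ} (hθ : 6 * G.edgeFinset.card ≤ θ ^ 2) {v : V}
    (hv : θ < G.degree v) : 2 / 3 ≤ lightFraction G θ v := by
  classical
  set l := ((G.neighborFinset v).filter fun w => G.degree w ≤ θ).card
  set h := ((G.neighborFinset v).filter fun w => ¬ G.degree w ≤ θ).card
  have hsum : l + h = G.degree v := card_light_add_card_heavy θ v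
  have hdegrees : h * (θ + 1) ≤ 2 * G.edgeFinset.card := by
    calc h * (θ + 1) ≤ ∑ w ∈ (G.neighborFinset v).filter fun w => ¬ G.degree w ≤ θ, G.degree w :=
          (nsmul_eq_mul h (θ + 1)).symm.le.trans <|
            Finset.card_nsmul_le_sum _ _ _ fun w hw => not_le.mp (Finset.mem_filter.mp hw).2
      _ ≤ ∑ w, G.degree w := Finset.sum_le_sum_of_subset (Finset.subset_univ _)
      _ = 2 * G.edgeFinset.card := G.sum_degrees_eq_twice_card_edges
  have hheavy : 3 * h ≤ θ := by
    by_contra!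
    nlinarith
  have hlight : 2 * G.degree v ≤ l * 3 := by lia
  rw [lightFraction, div_le_div_iff₀ (by norm_num) (by exact_mod_cast (Nat.zero_le θ).trans_lt hv)]
  exact_mod_cast hlight

section Halting

variable (L : IndexedAccess G) {θ : ℕ}

theorem randomNeighbor_haltsWithin (v : V) : (randomNeighbor v).HaltsWithin L.oracle 2 := by
  refine ((Prog.HaltsWithin.ask _).bind fun d => (Prog.HaltsWithin.sample _).bind (b := 1)
    fun j => ?_).mono (by norm_num)
  exact Prog.HaltsWithin.ask _

theorem askDegree_bind_haltsWithin {α : Type} {v : V} {g : ℕ → GraphProg V α} {a : ℝ≥0∞}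
    (hg : (g (G.degree v)).HaltsWithin L.oracle a) :
    ((askDegree v).bind g).HaltsWithin L.oracle (1 + a) where
  ev_one := by rw [Prog.ev_bind, ev_askDegree, zero_add, hg.ev_one]
  expectedQueries_le := by
    rw [Prog.expectedQueries, Prog.ev_bind, ev_askDegree]
    gcongr
    exact hg.expectedQueries_le

theorem tryEdge_haltsWithin (n : ℕ) : (tryEdge n θ).HaltsWithin L.oracle 6 := by
  refine ((Prog.HaltsWithin.sample _).bind fun i => (Prog.HaltsWithin.ask _).bind (b := 5)
    fun u => ?_).mono (by norm_num)
  rcases u with _ | u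
  · exact (Prog.HaltsWithin.ret _).mono zero_le
  refine ((Prog.HaltsWithin.sample _).bind fun j => (Prog.HaltsWithin.ask _).bind (b := 4)
    fun d => ?_).mono (by norm_num)
  split_ifs
  · exact (Prog.HaltsWithin.ret _).mono zero_le
  refine ((Prog.HaltsWithin.ask _).bind (b := 3) fun v => ?_).mono (by norm_num)
  rcases v with _ | v
  · exact (Prog.HaltsWithin.ret _).mono zero_le
  refine ((Prog.HaltsWithin.sample _).bind (b := 3) fun B => ?_).mono (by norm_num)
  split_ifs
  · exact (Prog.HaltsWithin.ret _).mono zero_le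
  refine ((Prog.HaltsWithin.ask _).bind (b := 2) fun d' => ?_).mono (by norm_num)
  split_ifs
  · refine ((randomNeighbor_haltsWithin L v).bind (b := 0) fun w => ?_).mono (by norm_num)
    rcases w with _ | w <;> exact .ret _
  · exact (Prog.HaltsWithin.ret _).mono zero_le

theorem edgeRound_haltsWithin {F : CoinProg} {K : NNReal}
    (hF : ∀ (p : NNReal) (hp : p ≤ 1), 2 / 3 ≤ p → F.HaltsWithin (coin p hp) K)
    (hθ : 6 * G.edgeFinset.card ≤ θ ^ 2) (n : ℕ) :
    (edgeRound F n θ).HaltsWithin L.oracle (7 + 3 * K) := by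
  refine ((tryEdge_haltsWithin L n).bind (b := 1 + 3 * K) fun x => ?_).mono
    (le_of_eq (by ring))
  rcases x with _ | ⟨v, w⟩
  · exact (Prog.HaltsWithin.ret _).mono zero_le
  refine askDegree_bind_haltsWithin L ?_
  split_ifs with hv
  · exact (Prog.HaltsWithin.ret _).mono zero_le
  refine (Prog.HaltsWithin.bind (b := 0) ?_ fun Y => ?_).mono (add_zero _).le
  · have htrial := two_thirds_le_lightFraction hθ (not_le.mp hv)
    exact (hF _ (lightFraction_le_one θ v) htrial).substQuery (k := 3) fun c _ f =>
      ev_lightNeighborTrial L c θ ((Nat.zero_le θ).trans_lt (not_le.mp hv)) f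
  · split_ifs <;> exact .ret _

end Halting

theorem sum_light_sum_neighborFinset (θ : ℕ) (h : V → ℝ≥0∞) :
    ∑ u, (if G.degree u ≤ θ then ∑ v ∈ G.neighborFinset u, h v else 0) =
      ∑ v, ((G.neighborFinset v).filter fun u => G.degree u ≤ θ).card * h v := by
  rw [← Finset.sum_filter, Finset.sum_comm' (t' := Finset.univ)
    (s' := fun v => (G.neighborFinset v).filter fun u => G.degree u ≤ θ)]
  · simp only [Finset.sum_const, nsmul_eq_mul]
  · simp [G.adj_comm, and_comm]

/-- The factor by which the attempt favors an edge leaving `v` over an edge leaving a light vertex: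
a heavy vertex `v` is reached through its light neighbors, and `2` is the odds of `B = 0` against
`B = 1`. -/
noncomputable def attemptWeight (G : SimpleGraph V) [DecidableRel G.Adj] (θ : ℕ) (v : V) : ℝ≥0∞ :=
  if G.degree v ≤ θ then 1 else 2 * lightFraction G θ v

theorem ev_tryEdge_eq_sum_light [Nonempty V] (L : IndexedAccess G) {θ : ℕ} (hθ : 0 < θ)
    {f : Option (V × V) → ℝ≥0∞} (hf : f none = 0) :
    (tryEdge (Fintype.card V) θ).ev L.oracle 0 f =
      (Fintype.card V : ℝ≥0∞)⁻¹ * ∑ u, (θ : ℝ≥0∞)⁻¹ * if G.degree u ≤ θ then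
        ∑ v ∈ G.neighborFinset u, 3⁻¹ * (f (some (u, v)) + 2 * if G.degree v ≤ θ then 0 else
          (G.degree v : ℝ≥0∞)⁻¹ * ∑ w ∈ G.neighborFinset v, f (some (v, w)))
      else 0 := by
  simp only [tryEdge, Prog.bind_eq, Prog.pure_eq, Prog.ev_bind, Prog.ev_sample,
    tsum_uniformBelow Fintype.card_pos, sum_ev_askVertex, tsum_uniformBelow hθ, ev_askDegree,
    zero_add, apply_ite (Prog.ev L.oracle 0 · f), Prog.ev_ret, hf, sum_range_ite_lt_or_le,
    sum_ev_askNeighbor, tsum_bern_one_third]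
  refine congrArg _ (Finset.sum_congr rfl fun u _ => congrArg _ (if_congr Iff.rfl
    (Finset.sum_congr rfl fun v hv => ?_) rfl))
  have hpos : 0 < G.degree v :=
    (G.degree_pos_iff_exists_adj v).mpr ⟨u, ((G.mem_neighborFinset u v).mp hv).symm⟩
  simp only [if_true, Bool.false_eq_true, if_false, ev_randomNeighbor L 0 hpos, Prog.ev_ret,
    mul_zero, zero_add, ← ite_not (G.degree v ≤ θ), not_le]

theorem ev_tryEdge [Nonempty V] (L : IndexedAccess G) {θ : ℕ} (hθ : 0 < θ)
    {f : Option (V × V) → ℝ≥0∞} (hf : f none = 0) :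
    (tryEdge (Fintype.card V) θ).ev L.oracle 0 f =
      (Fintype.card V : ℝ≥0∞)⁻¹ * (θ : ℝ≥0∞)⁻¹ * 3⁻¹ *
        ∑ v, attemptWeight G θ v * ∑ w ∈ G.neighborFinset v, f (some (v, w)) := by
  let S : V → ℝ≥0∞ := fun v => ∑ w ∈ G.neighborFinset v, f (some (v, w))
  let H : V → ℝ≥0∞ := fun v => if G.degree v ≤ θ then 0 else (G.degree v : ℝ≥0∞)⁻¹ * S v
  have hweight (v : V) : attemptWeight G θ v * S v = (if G.degree v ≤ θ then S v else 0) +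
      2 * (((G.neighborFinset v).filter fun u => G.degree u ≤ θ).card * H v) := by
    by_cases hv : G.degree v ≤ θ
    · simp [attemptWeight, H, hv]
    · simp only [attemptWeight, H, if_neg hv, coe_lightFraction θ
        ((Nat.zero_le θ).trans_lt (not_le.mp hv))]
      ring
  calc _ = (Fintype.card V : ℝ≥0∞)⁻¹ * ∑ u, (θ : ℝ≥0∞)⁻¹ * if G.degree u ≤ θ then
        ∑ v ∈ G.neighborFinset u, 3⁻¹ * (f (some (u, v)) + 2 * H v) else 0 :=
        ev_tryEdge_eq_sum_light L hθ hf
    _ = (Fintype.card V : ℝ≥0∞)⁻¹ * (θ : ℝ≥0∞)⁻¹ * 3⁻¹ *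
        (∑ u, (if G.degree u ≤ θ then S u else 0) +
          2 * ∑ u, if G.degree u ≤ θ then ∑ v ∈ G.neighborFinset u, H v else 0) := by
      simp only [mul_assoc, Finset.mul_sum, ← Finset.sum_add_distrib]
      refine Finset.sum_congr rfl fun u _ => ?_
      split_ifs
      · simp only [S, mul_add, Finset.sum_add_distrib, Finset.mul_sum]
      · simp
    _ = _ := by
      rw [sum_light_sum_neighborFinset, Finset.mul_sum, ← Finset.sum_add_distrib]
      simp only [hweight, S]

theorem attemptWeight_ne_zero {θ : ℕ} (hθ : 6 * G.edgeFinset.card ≤ θ ^ 2) (v : V) :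
    attemptWeight G θ v ≠ 0 := by
  rw [attemptWeight]
  split_ifs with hv
  · exact one_ne_zero
  · have hpos : 0 < lightFraction G θ v :=
      (two_thirds_le_lightFraction hθ (not_le.mp hv)).trans_lt' (by norm_num)
    exact mul_ne_zero two_ne_zero (ENNReal.coe_ne_zero.mpr hpos.ne')

theorem attemptWeight_ne_top (θ : ℕ) (v : V) : attemptWeight G θ v ≠ ∞ := by
  rw [attemptWeight]
  split_ifs
  · exact ENNReal.one_ne_top
  · exact ENNReal.mul_ne_top ENNReal.ofNat_ne_top ENNReal.coe_ne_top

theorem ev_edgeRound_eq_ev_tryEdge (L : IndexedAccess G) {F : CoinProg} (hF : IsInvTwoFactory F)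
    {θ : ℕ} (hθ : 6 * G.edgeFinset.card ≤ θ ^ 2) (n : ℕ) {f : Option (V × V) → ℝ≥0∞}
    (hf : f none = 0) :
    (edgeRound F n θ).ev L.oracle 0 f = (tryEdge n θ).ev L.oracle 0 fun r =>
      r.elim 0 fun x => (attemptWeight G θ x.1)⁻¹ * f (some x) := by
  rw [edgeRound, Prog.bind_eq, Prog.ev_bind]
  congr 1
  funext r
  obtain _ | ⟨v, w⟩ := r
  · exact (Prog.ev_ret ..).trans hf
  simp only [Prog.bind_eq, Prog.pure_eq, Prog.ev_bind, ev_askDegree, zero_add, Option.elim,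
    attemptWeight]
  split_ifs with hv
  · rw [Prog.ev_ret, inv_one, one_mul]
  · have hlight := two_thirds_le_lightFraction hθ (not_le.mp hv)
    have hpos : (0 : ℝ) < lightFraction G θ v := by
      exact_mod_cast hlight.trans_lt' (by norm_num)
    have hinv : ENNReal.ofReal (1 / (2 * (lightFraction G θ v : ℝ))) =
        (2 * (lightFraction G θ v : ℝ≥0∞))⁻¹ := by
      rw [one_div, ENNReal.ofReal_inv_of_pos (by positivity), ENNReal.ofReal_mul two_pos.le,
        ENNReal.ofReal_ofNat, ENNReal.ofReal_coe_nnreal]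
    rw [Prog.ev_bind, Prog.ev_substQuery _ L.oracle fun _ g => by
      simpa only [mul_zero] using
        ev_lightNeighborTrial L 0 θ ((Nat.zero_le θ).trans_lt (not_le.mp hv)) g,
      Prog.ev_bool, (hF.1 _ _ hlight).1, hinv]
    simp [Prog.ev_ret, hf]

theorem sum_dart_eq_sum_sum_neighborFinset (f : V × V → ℝ≥0∞) :
    ∑ d : G.Dart, f d.toProd = ∑ v, ∑ w ∈ G.neighborFinset v, f (v, w) := by
  rw [Finset.sum_sigma']
  refine Finset.sum_bij' (fun d _ => ⟨d.fst, d.snd⟩)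
    (fun x hx => ⟨(x.1, x.2), by simpa using hx⟩) ?_ ?_ ?_ ?_ ?_ <;> simp [SimpleGraph.Dart.adj]

theorem nonempty_of_card_edgeFinset_pos (hm : 0 < G.edgeFinset.card) : Nonempty V := by
  obtain ⟨e, -⟩ := Finset.card_pos.mp hm
  exact ⟨e.out.1⟩

section Uniform

variable (L : IndexedAccess G) {F : CoinProg} (hF : IsInvTwoFactory F) {θ : ℕ}
  (hθ : 6 * G.edgeFinset.card ≤ θ ^ 2)
include hF hθ

theorem ev_edgeRound [Nonempty V] (hθ₀ : 0 < θ) {f : Option (V × V) → ℝ≥0∞} (hf : f none = 0) :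
    (edgeRound F (Fintype.card V) θ).ev L.oracle 0 f =
      (Fintype.card V : ℝ≥0∞)⁻¹ * (θ : ℝ≥0∞)⁻¹ * 3⁻¹ * ∑ d : G.Dart, f (some d.toProd) := by
  rw [ev_edgeRound_eq_ev_tryEdge L hF hθ _ hf, ev_tryEdge L hθ₀ rfl,
    sum_dart_eq_sum_sum_neighborFinset fun x => f (some x)]
  congr 1
  refine Finset.sum_congr rfl fun v _ => ?_
  simp only [Option.elim, ← Finset.mul_sum]
  rw [← mul_assoc, ENNReal.mul_inv_cancel (attemptWeight_ne_zero hθ v) (attemptWeight_ne_top θ v),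
    one_mul]

theorem ev_edgeRound_success [Nonempty V] (hθ₀ : 0 < θ) :
    ((edgeRound F (Fintype.card V) θ).ev L.oracle 0 fun r => r.elim 0 1) =
      (Fintype.card V : ℝ≥0∞)⁻¹ * (θ : ℝ≥0∞)⁻¹ * 3⁻¹ * (2 * G.edgeFinset.card) := by
  classical
  rw [ev_edgeRound L hF hθ hθ₀ rfl]
  simp only [Option.elim, Finset.sum_const, Finset.card_univ, nsmul_eq_mul, mul_one, Pi.one_apply,
    G.dart_card_eq_twice_card_edges, Nat.cast_mul, Nat.cast_ofNat]

theorem prob_repeatUntil_edgeRound (hm : 0 < G.edgeFinset.card) (S : Set (V × V)) :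
    (Prog.repeatUntil (edgeRound F (Fintype.card V) θ)).prob L.oracle S =
      {d : G.Dart | d.toProd ∈ S}.ncard / (2 * G.edgeFinset.card) := by
  classical
  have : Nonempty V := nonempty_of_card_edgeFinset_pos hm
  have hθ₀ : 0 < θ := Nat.pos_of_ne_zero (by rintro rfl; lia)
  obtain ⟨K, hK⟩ := hF.exists_haltsWithin
  have hcount : ∑ d : G.Dart, S.indicator (1 : V × V → ℝ≥0∞) d.toProd =
      {d : G.Dart | d.toProd ∈ S}.ncard := by
    simp [Set.indicator_apply, Set.ncard_eq_toFinset_card']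
  rw [Prog.prob, Prog.ev_repeatUntil_of_halts _ _ (edgeRound_haltsWithin L hK hθ _).ev_one,
    ev_edgeRound_success L hF hθ hθ₀, ev_edgeRound L hF hθ hθ₀ rfl, ← hcount]
  exact ENNReal.mul_div_mul_left _ _ (by simp) (by simp [ENNReal.mul_eq_top, hθ₀.ne'])

theorem expectedQueries_repeatUntil_edgeRound_le (hm : 0 < G.edgeFinset.card) {K : NNReal}
    (hK : ∀ (p : NNReal) (hp : p ≤ 1), 2 / 3 ≤ p → F.HaltsWithin (coin p hp) K) :
    (Prog.repeatUntil (edgeRound F (Fintype.card V) θ)).expectedQueries L.oracle ≤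
      ENNReal.ofReal ((7 + 3 * K) * (3 / 2) * (Fintype.card V * θ / G.edgeFinset.card)) := by
  have : Nonempty V := nonempty_of_card_edgeFinset_pos hm
  have hθ₀ : 0 < θ := Nat.pos_of_ne_zero (by rintro rfl; lia)
  refine (edgeRound_haltsWithin L hK hθ _).expectedQueries_repeatUntil_le.trans_eq ?_
  rw [ev_edgeRound_success L hF hθ hθ₀]
  have hn : 0 < Fintype.card V := Fintype.card_pos
  have hround : (7 + 3 * K : ℝ≥0∞).toReal = 7 + 3 * K := by
    rw [ENNReal.toReal_add (by simp) (by finiteness)]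
    simp
  have hsuccess : (Fintype.card V : ℝ≥0∞)⁻¹ * (θ : ℝ≥0∞)⁻¹ * 3⁻¹ * (2 * G.edgeFinset.card) ≠ 0 := by
    simp [hm.ne']
  rw [← ENNReal.ofReal_toReal (ENNReal.div_ne_top (by finiteness) hsuccess), ENNReal.toReal_div,
    hround]
  congr 1
  simp only [ENNReal.toReal_mul, ENNReal.toReal_inv, ENNReal.toReal_natCast, ENNReal.toReal_ofNat]
  field_simp

end Uniform

end Graph

section Dart

variable {V : Type*} {G : SimpleGraph V}

theorem ncard_dart_edge {e : Sym2 V} (he : e ∈ G.edgeSet) :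
    {d : G.Dart | s(d.fst, d.snd) = e}.ncard = 2 := by
  induction e with
  | h u v =>
    let d : G.Dart := ⟨(u, v), he⟩
    have hfiber : {d' : G.Dart | s(d'.fst, d'.snd) = s(u, v)} = {d, d.symm} :=
      Set.ext fun d' => SimpleGraph.dart_edge_eq_iff d' d
    rw [hfiber, Set.ncard_pair d.symm_ne.symm]

theorem ncard_dart_toProd (u v : V) [Decidable (G.Adj u v)] :
    {d : G.Dart | d.toProd = (u, v)}.ncard = if G.Adj u v then 1 else 0 := by
  split_ifs with h
  · exact Set.ncard_eq_one.mpr ⟨⟨(u, v), h⟩, by ext d; simp [SimpleGraph.Dart.ext_iff]⟩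
  · have hempty : {d : G.Dart | d.toProd = (u, v)} = ∅ :=
      Set.eq_empty_iff_forall_notMem.mpr (by rintro ⟨x, hx⟩ rfl; exact h hx)
    rw [hempty, Set.ncard_empty]

end Dart

theorem six_mul_le_sq_ceil_sqrt {m : ℕ} {x : ℝ} (hx : (m : ℝ) ≤ x) :
    6 * m ≤ ⌈√(6 * x)⌉₊ ^ 2 := by
  have h : (6 * m : ℝ) ≤ (⌈√(6 * x)⌉₊ : ℝ) ^ 2 :=
    calc (6 * m : ℝ) ≤ 6 * x := by gcongr
      _ ≤ (⌈√(6 * x)⌉₊ : ℝ) ^ 2 := Real.sqrt_le_left (Nat.cast_nonneg _) |>.mp (Nat.le_ceil _)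
  exact_mod_cast h

theorem ceil_sqrt_le_mul_sqrt {m x b : ℝ} (hm : 1 ≤ m) (hx : x ≤ b * m) :
    (⌈√x⌉₊ : ℝ) ≤ (√b + 1) * √m :=
  calc (⌈√x⌉₊ : ℝ) ≤ √x + 1 := (Nat.ceil_lt_add_one x.sqrt_nonneg).le
    _ ≤ √b * √m + √m := by
        rw [← Real.sqrt_mul' b (zero_le_one.trans hm)]
        gcongr
        exact Real.one_le_sqrt.mpr hm
    _ = (√b + 1) * √m := by ring

theorem mul_div_le_mul_div_sqrt {n x b m : ℝ} (hn : 0 ≤ n) (hm : 0 ≤ m) (hx : x ≤ b * √m) :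
    n * x / m ≤ b * (n / √m) :=
  calc n * x / m ≤ n * (b * √m) / m := by gcongr
    _ = b * (n * (√m / m)) := by ring
    _ = b * (n / √m) := by rw [Real.sqrt_div_self', mul_one_div]

theorem mainTheorem1 :
    (∃ F : CoinProg, IsInvTwoFactory F) ∧
    ∀ F : CoinProg, IsInvTwoFactory F → ∀ a : ℝ, ∃ C : ℝ,
      ∀ (V : Type) [Fintype V] [DecidableEq V] (G : SimpleGraph V) [DecidableRel G.Adj]
        (L : IndexedAccess G) (mt : ℝ),
        0 < G.edgeFinset.card →
        (G.edgeFinset.card : ℝ) ≤ mt → mt ≤ a * (G.edgeFinset.card : ℝ) →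
        (∀ e ∈ G.edgeFinset,
          (sampleEdge F (Fintype.card V) mt).prob L.oracle {x : V × V | s(x.1, x.2) = e} =
            1 / (G.edgeFinset.card : ENNReal)) ∧
        (∀ u v : V,
          (sampleEdge F (Fintype.card V) mt).prob L.oracle {(u, v)} =
            if G.Adj u v then 1 / (2 * (G.edgeFinset.card : ENNReal)) else 0) ∧
        (sampleEdge F (Fintype.card V) mt : GraphProg V (V × V)).expectedQueries L.oracle ≤
          ENNReal.ofReal (C * ((Fintype.card V : ℝ) / √(G.edgeFinset.card : ℝ))) := by
  refine ⟨⟨_, InvTwoFactory.factory_isInvTwoFactory⟩, fun F hF a => ?_⟩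
  obtain ⟨K, hK⟩ := hF.exists_haltsWithin
  refine ⟨(7 + 3 * K) * (3 / 2) * (√(6 * a) + 1), fun V _ _ G _ L mt hm hle hge => ?_⟩
  have hθ : 6 * G.edgeFinset.card ≤ ⌈√(6 * mt)⌉₊ ^ 2 := six_mul_le_sq_ceil_sqrt hle
  have hprob (S : Set (V × V)) : (sampleEdge F (Fintype.card V) mt).prob L.oracle S = _ :=
    prob_repeatUntil_edgeRound L hF hθ hm S
  refine ⟨fun e he => ?_, fun u v => ?_, ?_⟩
  · rw [hprob]
    simp only [Set.mem_ofPred_eq, ncard_dart_edge (SimpleGraph.mem_edgeFinset.mp he)]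
    simpa using ENNReal.mul_div_mul_left 1 (G.edgeFinset.card : ℝ≥0∞) two_ne_zero
      ENNReal.ofNat_ne_top
  · rw [hprob]
    simp only [Set.mem_singleton_iff, ncard_dart_toProd]
    split_ifs <;> simp
  · have hθ_le : (⌈√(6 * mt)⌉₊ : ℝ) ≤ (√(6 * a) + 1) * √G.edgeFinset.card :=
      ceil_sqrt_le_mul_sqrt (mod_cast hm) (by linarith)
    refine (expectedQueries_repeatUntil_edgeRound_le L hF hθ hm hK).trans ?_
    rw [mul_assoc _ (√(6 * a) + 1)]
    gcongr
    exact mul_div_le_mul_div_sqrt (Nat.cast_nonneg _) (Nat.cast_nonneg _) hθ_le
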